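/- Let $\mathbf{F}_q$ be a finite field with $q\geq 4$ elements, and let $P$ be a closed point of degree $3$ of the projective plane $\mathbf{P}^2$ over $\mathbf{F}_q$ (that is, an orbit $\{p,p^{\varphi},p^{\varphi^2}\}$ with exactly three elements of the $q$-power Frobenius map $\varphi$ on $\mathbf{P}^2(\overline{\mathbf{F}}_q)$) which is not contained in any line defined over $\mathbf{F}_q$. Let $\Gamma_4$ be the linear system of plane quartics containing $P$; its $\mathbf{F}_q$-rational elements are the curves $C=\{f=0\}$, possibly reducible or non-reduced, where $f\in\mathbf{F}_q[x,y,z]$ is a nonzero homogeneous polynomial of degree $4$ vanishing at the points of $P$. Then every $\mathbf{F}_q$-rational element $C$ of $\Gamma_4$ satisfies $$\sharp C(\mathbf{F}_q)\leq 3q+2,$$ where $C(\mathbf{F}_q)$ is the set of points of $\mathbf{P}^2(\mathbf{F}_q)$ lying on $C$, and for every such $P$ this bound is attained by some $\mathbf{F}_q$-rational element of $\Gamma_4$. -/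

import Mathlib

open scoped LinearAlgebra.Projectivization

noncomputable section

namespace PlaneCurves

/-- The set `ℙ²(L)` of `L`-points of the projective plane. -/
abbrev Plane (L : Type*) [Field L] : Type _ := ℙ L (Fin 3 → L)

/-- The form `f` with coefficients in `F` vanishes at the point `x` of `ℙ²(L)`. For homogeneous `f`
the choice of the representative does not matter, see `vanishesAt_mk_iff`. -/
def VanishesAt {F L : Type*} [Field F] [Field L] [Algebra F L]
    (f : MvPolynomial (Fin 3) F) (x : Plane L) : Prop :=
  MvPolynomial.aeval x.rep f = 0

theorem vanishesAt_mk_iff {F L : Type*} [Field F] [Field L] [Algebra F L]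
    {f : MvPolynomial (Fin 3) F} {d : ℕ} (hf : f.IsHomogeneous d) (v : Fin 3 → L) (hv : v ≠ 0) :
    VanishesAt f (Projectivization.mk L v hv) ↔ MvPolynomial.aeval v f = 0 := by
  obtain ⟨a, ha⟩ := Projectivization.exists_smul_eq_mk_rep L v hv
  have h : MvPolynomial.aeval (a • v) f = (a : L) ^ d * MvPolynomial.aeval v f := by
    rw [MvPolynomial.aeval_def, MvPolynomial.aeval_def, MvPolynomial.eval₂_eq',
      MvPolynomial.eval₂_eq', Finset.mul_sum]
    refine Finset.sum_congr rfl fun m hm => ?_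
    have hd : ∑ i, m i = d := by
      have h1 := hf (MvPolynomial.mem_support_iff.mp hm)
      rw [Finsupp.weight_apply, Finsupp.sum_fintype _ _ (by simp)] at h1
      simpa using h1
    have hs : ∀ i, (a • v) i = (a : L) * v i := fun i => rfl
    simp only [hs, mul_pow, Finset.prod_mul_distrib, Finset.prod_pow_eq_pow_sum, hd]
    ring
  unfold VanishesAt
  rw [← ha, h]
  simp

/-- The equations of the plane curves of degree `d` defined over `F` (repeated and reducible
components allowed): nonzero ternary forms of degree `d` with coefficients in `F`. -/
def IsCurveEquation {F : Type*} [Field F] (d : ℕ) (f : MvPolynomial (Fin 3) F) : Prop :=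
  f ≠ 0 ∧ f.IsHomogeneous d

/-- The set of `F`-rational points of the plane curve `f = 0`. -/
def rationalPoints {F : Type*} [Field F] (f : MvPolynomial (Fin 3) F) : Set (Plane F) :=
  {x | VanishesAt f x}

/-- The coordinatewise map `v ↦ (σ (v i))ᵢ`, as a `σ`-semilinear map. -/
def coordMap {L : Type*} [Field L] (σ : L →+* L) : (Fin 3 → L) →ₛₗ[σ] (Fin 3 → L) where
  toFun v i := σ (v i)
  map_add' v w := by ext i; simp
  map_smul' c v := by ext i; simp

theorem coordMap_injective {L : Type*} [Field L] (σ : L →+* L) :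
    Function.Injective (coordMap σ) := fun _ _ h =>
  funext fun i => σ.injective (congrFun h i)

/-- The `q`-power Frobenius map `[x : y : z] ↦ [x ^ q : y ^ q : z ^ q]`, `q = #F`, on the geometric
points of the projective plane over the finite field `F`. -/
def frobenius (F : Type*) [Field F] [Fintype F] :
    Plane (AlgebraicClosure F) → Plane (AlgebraicClosure F) :=
  Projectivization.map
    (coordMap (FiniteField.frobeniusAlgHom F (AlgebraicClosure F)).toRingHom)
    (coordMap_injective _)

/-- `P` is (the set of geometric points of) a closed point of degree `d` of the projective plane
over the finite field `F`: the Frobenius orbit of a geometric point, having `d` elements. -/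
def IsClosedPointOfDegree {F : Type*} [Field F] [Fintype F] (d : ℕ)
    (P : Set (Plane (AlgebraicClosure F))) : Prop :=
  (∃ p, P = Set.range fun n : ℕ => (frobenius F)^[n] p) ∧ P.ncard = d

/-- The plane curve `f = 0` contains the closed point `P`. -/
def Contains {F : Type*} [Field F] (f : MvPolynomial (Fin 3) F)
    (P : Set (Plane (AlgebraicClosure F))) : Prop :=
  ∀ p ∈ P, VanishesAt f p

/-- `P` is contained in no `F`-rational line. -/
def InNoRationalLine {F : Type*} [Field F] (P : Set (Plane (AlgebraicClosure F))) : Prop :=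
  ∀ l : MvPolynomial (Fin 3) F, IsCurveEquation 1 l → ¬ Contains l P

/-- The `F`-rational elements of the linear system of the plane curves of degree `d` that
contain `P`, given by their equations. -/
def rationalLinearSystem {F : Type*} [Field F] (d : ℕ)
    (P : Set (Plane (AlgebraicClosure F))) : Set (MvPolynomial (Fin 3) F) :=
  {f | IsCurveEquation d f ∧ Contains f P}

end PlaneCurves

end

open scoped LinearAlgebra.Projectivization

namespace PlaneCurves

/-! Upper bound. Let `v` represent a point of `P`; no rational line passes through it. Rational
linear factors of the quartic are split off, and since none of them vanishes at `v`, the cofactor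
still does. Three cases remain. A quartic without linear factor has fewer than `3(q+1)` points. A
line and a cubic without linear factor have at most `(q+1) + (2q+1)`. Two lines and a conic through
`v` have at most `(2q+1) + (q+1)`; such a conic has no linear factor, since one of its two factors
would vanish at `v`.

The bounds for curves of degree `n` without linear factor come from counting along the `q+1` lines
through a rational point `u` of the curve. Each carries at most `n-1` further points, and a tangent
one at most `n-2`, which gives Segre's bound `(n-1)(q+1)` (`ncard_rationalPoints_le`). For `n ≥ 3`
equality would produce a line touching the curve at two points while having too many points on it
(`ncard_rationalPoints_lt`).

Sharpness. The points of `P` have coordinates in the field with `q³` elements, so among the `q⁴`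
conics of a four-dimensional family with two rational base points some nonzero one contains `P`
(`exists_conic`). It has exactly `q+1` rational points. Through a rational point off the conic that
lies on two secants there are at least two lines missing the conic, because `q+1` points are spread
over `q+1` lines. The conic and these two lines together have `(q+1) + (2q+1)` points
(`exists_ncard_rationalPoints_mul`). -/

open MvPolynomial in
theorem aeval_mul_of_isHomogeneous {F A : Type*} [Field F] [CommRing A] [Algebra F A]
    {f : MvPolynomial (Fin 3) F} {d : ℕ} (hf : f.IsHomogeneous d) (a : A) (v : Fin 3 → A) :
    aeval (fun i => a * v i) f = a ^ d * aeval v f := by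
  rw [aeval_def, aeval_def, eval₂_eq', eval₂_eq', Finset.mul_sum]
  refine Finset.sum_congr rfl fun m hm => ?_
  have hd : ∑ i, m i = d := by
    have h1 := hf (mem_support_iff.mp hm)
    rw [Finsupp.weight_apply, Finsupp.sum_fintype _ _ (by simp)] at h1
    simpa using h1
  simp only [mul_pow, Finset.prod_mul_distrib, Finset.prod_pow_eq_pow_sum, hd]
  ring

/-- The linear form with coefficient vector `a`. -/
noncomputable def linForm {F : Type*} [Field F] (a : Fin 3 → F) : MvPolynomial (Fin 3) F :=
  ∑ i, MvPolynomial.C (a i) * MvPolynomial.X i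

/-- `f` has no linear factor. -/
def NoLinearFactor {F : Type*} [Field F] (f : MvPolynomial (Fin 3) F) : Prop :=
  ∀ a : Fin 3 → F, a ≠ 0 → ¬ linForm a ∣ f

/-- The restriction `f (w + X u)` of `f` to the line through `w` in direction `u`. -/
noncomputable def restrict {F : Type*} [Field F] (f : MvPolynomial (Fin 3) F) (w u : Fin 3 → F) :
    Polynomial F :=
  MvPolynomial.aeval (fun i => Polynomial.C (w i) + Polynomial.C (u i) * Polynomial.X) f

/-- The differential of `f` at `u`, applied to `w`. -/
noncomputable def tangent {F : Type*} [Field F] (f : MvPolynomial (Fin 3) F) (u : Fin 3 → F) :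
    (Fin 3 → F) →ₗ[F] F :=
  ∑ i, MvPolynomial.aeval u (MvPolynomial.pderiv i f) • LinearMap.proj i

/-! ### Restriction of a form to a line -/

section
variable {F : Type*} [Field F] {f : MvPolynomial (Fin 3) F} {d : ℕ}

theorem isHomogeneous_linForm (a : Fin 3 → F) : (linForm a).IsHomogeneous 1 :=
  MvPolynomial.IsHomogeneous.sum _ _ _ fun _ _ => MvPolynomial.isHomogeneous_C_mul_X _ _

theorem aeval_linForm_eq_dot (a v : Fin 3 → F) :
    MvPolynomial.aeval v (linForm a) = ∑ i, a i * v i := by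
  simp [linForm]

theorem linForm_ne_zero {a : Fin 3 → F} (ha : a ≠ 0) : linForm a ≠ 0 := by
  intro h
  apply ha
  ext i
  have := congrArg (MvPolynomial.aeval (Pi.single i (1 : F))) h
  simpa [aeval_linForm_eq_dot, Pi.single_apply] using this

theorem isCurveEquation_linForm {a : Fin 3 → F} (ha : a ≠ 0) : IsCurveEquation 1 (linForm a) :=
  ⟨linForm_ne_zero ha, isHomogeneous_linForm a⟩

theorem aeval_restrict {A : Type*} [CommRing A] [Algebra F A] (f : MvPolynomial (Fin 3) F)
    (w u : Fin 3 → F) (t : A) :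
    Polynomial.aeval t (restrict f w u) =
      MvPolynomial.aeval (fun i => algebraMap F A (w i) + algebraMap F A (u i) * t) f := by
  rw [restrict, ← AlgHom.comp_apply, MvPolynomial.comp_aeval]
  simp

theorem eval_restrict (f : MvPolynomial (Fin 3) F) (w u : Fin 3 → F) (t : F) :
    (restrict f w u).eval t = MvPolynomial.aeval (w + t • u) f := by
  have := aeval_restrict f w u t
  rw [Polynomial.coe_aeval_eq_eval] at this
  rw [this]
  congr 2
  ext i
  simp [mul_comm]

theorem coeff_zero_restrict (f : MvPolynomial (Fin 3) F) (w u : Fin 3 → F) :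
    (restrict f w u).coeff 0 = MvPolynomial.aeval w f := by
  rw [Polynomial.coeff_zero_eq_eval_zero, eval_restrict]
  simp

open Polynomial in
theorem derivative_aeval (f : MvPolynomial (Fin 3) F) (g : Fin 3 → F[X]) :
    derivative (MvPolynomial.aeval g f) =
      ∑ i, MvPolynomial.aeval g (MvPolynomial.pderiv i f) * derivative (g i) := by
  induction f using MvPolynomial.induction_on with
  | C a => simp
  | add p q hp hq => simp [hp, hq, add_mul, Finset.sum_add_distrib]
  | mul_X p j hp =>
    have h : ∀ i, MvPolynomial.aeval g (MvPolynomial.pderiv i (p * MvPolynomial.X j)) *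
        derivative (g i) = MvPolynomial.aeval g (MvPolynomial.pderiv i p) * derivative (g i) * g j +
          if i = j then MvPolynomial.aeval g p * derivative (g j) else 0 := by
      intro i
      rw [MvPolynomial.pderiv_mul, MvPolynomial.pderiv_X]
      split_ifs with hij
      · subst hij
        simp only [map_add, map_mul, MvPolynomial.aeval_X, Pi.single_eq_same, map_one]
        ring
      · simp only [map_add, map_mul, MvPolynomial.aeval_X, Pi.single_eq_of_ne' hij, map_zero]
        ring
    rw [Finset.sum_congr rfl fun i _ => h i, Finset.sum_add_distrib, ← Finset.sum_mul, ← hp,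
      Finset.sum_ite_eq', if_pos (Finset.mem_univ j), map_mul, MvPolynomial.aeval_X, derivative_mul]

/-- The chain rule at parameter `0`. -/
theorem coeff_one_restrict (f : MvPolynomial (Fin 3) F) (w u : Fin 3 → F) :
    (restrict f w u).coeff 1 = tangent f w u := by
  have h : (restrict f w u).coeff 1 = (Polynomial.derivative (restrict f w u)).eval 0 := by
    rw [← Polynomial.coeff_zero_eq_eval_zero, Polynomial.coeff_derivative]
    simp
  rw [h, restrict, derivative_aeval, Polynomial.eval_finsetSum, tangent]
  simp only [LinearMap.sum_apply, LinearMap.smul_apply, LinearMap.proj_apply, smul_eq_mul]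
  refine Finset.sum_congr rfl fun i _ => ?_
  have := eval_restrict (MvPolynomial.pderiv i f) w u 0
  rw [restrict] at this
  simp only [Polynomial.eval_mul, this]
  simp

open Polynomial in
theorem natDegree_restrict_le (hf : f.IsHomogeneous d) (w u : Fin 3 → F) :
    (restrict f w u).natDegree ≤ d := by
  rw [restrict, MvPolynomial.aeval_def, MvPolynomial.eval₂_eq']
  refine natDegree_sum_le_of_forall_le _ _ fun m hm => ?_
  have hd : ∑ i, m i = d := by
    have h1 := hf (MvPolynomial.mem_support_iff.mp hm)
    rw [Finsupp.weight_apply, Finsupp.sum_fintype _ _ (by simp)] at h1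
    simpa using h1
  refine (natDegree_C_mul_le _ _).trans ((natDegree_prod_le _ _).trans ?_)
  rw [← hd]
  refine Finset.sum_le_sum fun i _ => ?_
  have h : (C (w i) + C (u i) * X : F[X]).natDegree ≤ 1 := by
    rw [add_comm]; exact natDegree_linear_le
  exact natDegree_pow_le.trans (by nlinarith)

open Polynomial in
-- Both sides dehomogenize the binary form `f (S w + T u)`, and reversing the coefficients exchanges
-- `S` and `T`. Thus the behaviour of `f` at `u`, the point at infinity of the parametrization, is
-- read off from the top coefficients.
theorem reflect_restrict (hf : f.IsHomogeneous d) (w u : Fin 3 → F) :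
    reflect d (restrict f w u) = restrict f u w := by
  have hlin : ∀ a b : F, (C a + C b * X : F[X]).natDegree ≤ 1 := fun a b => by
    rw [add_comm]; exact natDegree_linear_le
  have hpow : ∀ (a b : F) (n : ℕ), reflect n ((C a + C b * X) ^ n) = (C b + C a * X) ^ n := by
    intro a b n
    induction n with
    | zero => simp
    | succ n ih =>
      rw [pow_succ, reflect_mul _ _ (natDegree_pow_le.trans (by nlinarith [hlin a b])) (hlin a b),
        ih, pow_succ]
      congr 1
      rw [reflect_add, reflect_C, reflect_C_mul, reflect_one_X]
      ring
  have hdeg : ∀ (a b : F) (n : ℕ), ((C a + C b * X) ^ n : F[X]).natDegree ≤ n := fun a b n =>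
    natDegree_pow_le.trans (by nlinarith [hlin a b])
  have hsum : ∀ (s : Finset (Fin 3 →₀ ℕ)) (g : (Fin 3 →₀ ℕ) → F[X]),
      reflect d (∑ m ∈ s, g m) = ∑ m ∈ s, reflect d (g m) := by
    intro s g
    ext
    simp [coeff_reflect]
  rw [restrict, restrict, MvPolynomial.aeval_def, MvPolynomial.aeval_def, MvPolynomial.eval₂_eq',
    MvPolynomial.eval₂_eq', hsum]
  refine Finset.sum_congr rfl fun m hm => ?_
  have hd : ∑ i, m i = d := by
    have h1 := hf (MvPolynomial.mem_support_iff.mp hm)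
    rw [Finsupp.weight_apply, Finsupp.sum_fintype _ _ (by simp)] at h1
    simpa using h1
  rw [algebraMap_eq, reflect_C_mul]
  congr 1
  rw [← hd]
  simp only [Fin.sum_univ_three, Fin.prod_univ_three]
  rw [reflect_mul _ _ _ (hdeg _ _ _), reflect_mul _ _ (hdeg _ _ _) (hdeg _ _ _), hpow, hpow, hpow]
  exact natDegree_mul_le.trans (add_le_add (hdeg _ _ _) (hdeg _ _ _))

theorem coeff_restrict_comm (hf : f.IsHomogeneous d) (w u : Fin 3 → F) {k : ℕ} (hk : k ≤ d) :
    (restrict f w u).coeff (d - k) = (restrict f u w).coeff k := by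
  rw [← reflect_restrict hf w u, Polynomial.coeff_reflect, Polynomial.revAt_le hk]

theorem tangent_self (hf : f.IsHomogeneous d) {u : Fin 3 → F} (hu : MvPolynomial.aeval u f = 0) :
    tangent f u u = 0 := by
  have h := congrArg (MvPolynomial.aeval u) hf.sum_X_mul_pderiv
  simp only [map_sum, map_mul, MvPolynomial.aeval_X, map_nsmul, hu, smul_zero] at h
  simp only [tangent, LinearMap.sum_apply, LinearMap.smul_apply, LinearMap.proj_apply, smul_eq_mul]
  rw [← h]
  exact Finset.sum_congr rfl fun i _ => mul_comm _ _

theorem aeval_smul_eq_zero_iff (hf : f.IsHomogeneous d) {c : F} (hc : c ≠ 0) (v : Fin 3 → F) :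
    MvPolynomial.aeval (c • v) f = 0 ↔ MvPolynomial.aeval v f = 0 := by
  have : MvPolynomial.aeval (c • v) f = c ^ d * MvPolynomial.aeval v f :=
    aeval_mul_of_isHomogeneous hf c v
  rw [this]
  simp [hc]

/-- Comparing components of degree `d + 1` and cancelling the linear form shows that `g` equals its
component of degree `d`. -/
theorem isHomogeneous_of_linForm_mul {a : Fin 3 → F} (ha : a ≠ 0) {g : MvPolynomial (Fin 3) F}
    (h : (linForm a * g).IsHomogeneous (d + 1)) : g.IsHomogeneous d := by
  have h1 : linForm a * g = linForm a * MvPolynomial.homogeneousComponent d g := by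
    conv_lhs => rw [← MvPolynomial.homogeneousComponent_eq_self h]
    conv_lhs => rw [← MvPolynomial.sum_homogeneousComponent g]
    rw [Finset.mul_sum, map_sum]
    have h2 : ∀ i, MvPolynomial.homogeneousComponent (d + 1)
        (linForm a * MvPolynomial.homogeneousComponent i g) =
        if i = d then linForm a * MvPolynomial.homogeneousComponent i g else 0 := by
      intro i
      have := (MvPolynomial.homogeneousComponent_of_mem (m := d + 1) (n := 1 + i)
        ((isHomogeneous_linForm a).mul (MvPolynomial.homogeneousComponent_isHomogeneous i g)))
      rw [this]
      exact if_congr (by omega) rfl rfl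
    simp only [h2]
    rw [Finset.sum_ite_eq' ]
    split_ifs with h3
    · rfl
    · rw [MvPolynomial.homogeneousComponent_eq_zero, mul_zero]
      simpa using h3
  rw [mul_left_cancel₀ (linForm_ne_zero ha) h1]
  exact MvPolynomial.homogeneousComponent_isHomogeneous d g

end

/-! ### Forms vanishing on a line -/

section
variable {F : Type*} [Field F] {f : MvPolynomial (Fin 3) F} {d : ℕ}

open MvPolynomial in
-- In the coordinates dual to `B`, the line spanned by `B 0` and `B 1` is the zero locus of the
-- third one. Modulo that linear form, `f` becomes its restriction to the line, homogenized, which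
-- is zero.
theorem exists_linForm_dvd_of_restrict_eq_zero (hf : f.IsHomogeneous d)
    (B : Module.Basis (Fin 3) F (Fin 3 → F)) (h : restrict f (B 1) (B 0) = 0) :
    ∃ a : Fin 3 → F, a ≠ 0 ∧ linForm a ∣ f := by
  -- The rows of the dual basis: `linForm (a k)` is the `k`-th coordinate with respect to `B`.
  let a : Fin 3 → Fin 3 → F := fun k j => B.repr (Pi.single j 1) k
  have ha : ∀ k, a k ≠ 0 := by
    intro k hk
    have h0 : B.coord k = 0 := by
      refine (Pi.basisFun F (Fin 3)).ext fun j => ?_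
      simpa [a] using congrFun hk j
    have := congrArg (fun l => l (B k)) h0
    simp at this
  have hX : ∀ i, (X i : MvPolynomial (Fin 3) F) = ∑ k, linForm (a k) * C (B k i) := by
    intro i
    have h1 : ∀ j, ∑ k, a k j * B k i = (Pi.single j 1 : Fin 3 → F) i := by
      intro j
      have := congrFun (B.sum_repr (Pi.single j 1)) i
      simpa using this
    simp only [linForm, Finset.sum_mul]
    rw [Finset.sum_comm]
    have h2 : ∀ j, ∑ k, C (a k j) * X j * C (B k i) =
        X j * (C ((Pi.single j 1 : Fin 3 → F) i) : MvPolynomial (Fin 3) F) := by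
      intro j
      rw [← h1, map_sum, Finset.mul_sum]
      exact Finset.sum_congr rfl fun k _ => by rw [map_mul]; ring
    simp only [h2]
    rw [Finset.sum_eq_single i]
    · simp
    · intro j _ hj
      simp [hj.symm]
    · simp
  refine ⟨a 2, ha 2, ?_⟩
  let R := MvPolynomial (Fin 3) F
  let K := FractionRing R
  have hinj : Function.Injective (algebraMap R K) := IsFractionRing.injective R K
  -- With `l₀`, `l₁` the first two coordinates, `f (l₀ B₀ + l₁ B₁) = l₁ ^ d * f (B₁ + (l₀ / l₁) B₀)`
  -- in the fraction field, and the last factor is a value of the zero polynomial `restrict f (B 1)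
  -- (B 0)`.
  have h0 : aeval (fun i => linForm (a 0) * C (B 0 i) + linForm (a 1) * C (B 1 i)) f = 0 := by
    apply hinj
    have hne : algebraMap R K (linForm (a 1)) ≠ 0 := by
      rw [Ne, map_eq_zero_iff _ hinj]
      exact linForm_ne_zero (ha 1)
    have h1 := aeval_restrict f (B 1) (B 0)
      (algebraMap R K (linForm (a 0)) / algebraMap R K (linForm (a 1)))
    rw [h, map_zero] at h1
    have h2 := aeval_mul_of_isHomogeneous hf (algebraMap R K (linForm (a 1)))
      (fun i => algebraMap F K (B 1 i) + algebraMap F K (B 0 i) *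
        (algebraMap R K (linForm (a 0)) / algebraMap R K (linForm (a 1))))
    rw [← h1, mul_zero] at h2
    rw [(algebraMap R K).map_zero, ← h2, ← MvPolynomial.aeval_algebraMap_apply]
    congr 2
    ext i
    have hC : ∀ c : F, algebraMap R K (C c) = algebraMap F K c := fun c =>
      (IsScalarTower.algebraMap_apply F R K c).symm
    rw [Function.comp_apply, map_add, map_mul, map_mul, hC, hC]
    rw [mul_add, mul_left_comm, ← mul_div_assoc, mul_div_cancel_left₀ _ hne]
    ring
  rw [← Ideal.mem_span_singleton, ← Ideal.Quotient.eq_zero_iff_mem]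
  set I := Ideal.span {linForm (a 2)}
  have h1 : f = aeval X f := by simp
  have h2 : Ideal.Quotient.mkₐ F I (aeval X f) = Ideal.Quotient.mkₐ F I
      (aeval (fun i => linForm (a 0) * C (B 0 i) + linForm (a 1) * C (B 1 i)) f) := by
    rw [← AlgHom.comp_apply, ← AlgHom.comp_apply, comp_aeval, comp_aeval]
    congr 2
    ext i
    simp only [Ideal.Quotient.mkₐ_eq_mk]
    rw [hX i, Ideal.Quotient.eq, Fin.sum_univ_three, add_sub_cancel_left]
    exact I.mul_mem_right _ (Ideal.mem_span_singleton_self _)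
  rw [h0, map_zero] at h2
  conv_lhs => rw [h1]
  exact h2

theorem exists_linearIndependent_triple {u w : Fin 3 → F} (h : LinearIndependent F ![u, w]) :
    ∃ e, LinearIndependent F ![u, w, e] := by
  obtain ⟨e, he⟩ := exists_linearIndependent_snoc_of_lt_finrank (R := F) h (by simp)
  have : (Fin.snoc ![u, w] e : Fin 3 → Fin 3 → F) = ![u, w, e] := by
    funext i
    fin_cases i <;> rfl
  exact ⟨e, this ▸ he⟩

theorem NoLinearFactor.restrict_ne_zero (hn : NoLinearFactor f) (hf : f.IsHomogeneous d)
    {u w : Fin 3 → F} (h : LinearIndependent F ![u, w]) : restrict f w u ≠ 0 := by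
  intro h0
  obtain ⟨e, he⟩ := exists_linearIndependent_triple h
  let B := basisOfLinearIndependentOfCardEqFinrank he (by simp)
  have hB : ⇑B = ![u, w, e] := coe_basisOfLinearIndependentOfCardEqFinrank he _
  obtain ⟨a, ha, hd⟩ := exists_linForm_dvd_of_restrict_eq_zero hf B (by rw [hB]; exact h0)
  exact hn a ha hd

end

/-- The number of zeros of `f` on the line through `w` and `u`, the point `u` excepted. -/
noncomputable def lineZeros {F : Type*} [Field F] (f : MvPolynomial (Fin 3) F)
    (u w : Fin 3 → F) : ℕ :=
  {t : F | MvPolynomial.aeval (w + t • u) f = 0}.ncard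

/-! ### Zeros on a line through a point of the curve -/

section
variable {F : Type*} [Field F] {f : MvPolynomial (Fin 3) F} {d : ℕ}

theorem lineZeros_le_natDegree {u w : Fin 3 → F} (h : restrict f w u ≠ 0) :
    lineZeros f u w ≤ (restrict f w u).natDegree := by
  classical
  have : {t : F | MvPolynomial.aeval (w + t • u) f = 0} = ↑(restrict f w u).roots.toFinset := by
    ext t
    simp [h, Polynomial.IsRoot, eval_restrict]
  rw [lineZeros, this, Set.ncard_coe_finset]
  exact (Multiset.toFinset_card_le _).trans (Polynomial.card_roots' _)

/-- The coefficient of degree `d + 1` is the value of `f` at `u`. -/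
theorem natDegree_restrict_le_of_aeval_eq_zero (hf : f.IsHomogeneous (d + 1)) {u : Fin 3 → F}
    (hu : MvPolynomial.aeval u f = 0) (w : Fin 3 → F) : (restrict f w u).natDegree ≤ d := by
  refine Polynomial.natDegree_le_iff_coeff_eq_zero.mpr fun k hk => ?_
  rcases (Nat.succ_le_of_lt hk).eq_or_lt with h | h
  · have := coeff_restrict_comm hf w u (Nat.zero_le (d + 1))
    rw [coeff_zero_restrict, hu] at this
    rw [← h]
    exact this
  · exact Polynomial.coeff_eq_zero_of_natDegree_lt ((natDegree_restrict_le hf w u).trans_lt h)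

/-- Tangency at `u` kills the second highest coefficient as well. -/
theorem natDegree_restrict_le_of_tangent_eq_zero (hf : f.IsHomogeneous (d + 2)) {u : Fin 3 → F}
    (hu : MvPolynomial.aeval u f = 0) {w : Fin 3 → F} (hw : tangent f u w = 0) :
    (restrict f w u).natDegree ≤ d := by
  refine Polynomial.natDegree_le_iff_coeff_eq_zero.mpr fun k hk => ?_
  rcases (Nat.succ_le_of_lt hk).eq_or_lt with h | h
  · have := coeff_restrict_comm hf w u (k := 1) (by omega)
    rw [coeff_one_restrict, hw] at this
    rw [← h]
    exact this
  · exact Polynomial.coeff_eq_zero_of_natDegree_lt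
      ((natDegree_restrict_le_of_aeval_eq_zero hf hu w).trans_lt h)

theorem lineZeros_le_of_aeval_eq_zero (hn : NoLinearFactor f) (hf : f.IsHomogeneous (d + 1))
    {u w : Fin 3 → F} (h : LinearIndependent F ![u, w]) (hu : MvPolynomial.aeval u f = 0) :
    lineZeros f u w ≤ d :=
  (lineZeros_le_natDegree (hn.restrict_ne_zero hf h)).trans
    (natDegree_restrict_le_of_aeval_eq_zero hf hu _)

theorem lineZeros_le_of_tangent_eq_zero (hn : NoLinearFactor f) (hf : f.IsHomogeneous (d + 2))
    {u w : Fin 3 → F} (h : LinearIndependent F ![u, w]) (hu : MvPolynomial.aeval u f = 0)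
    (hw : tangent f u w = 0) : lineZeros f u w ≤ d :=
  (lineZeros_le_natDegree (hn.restrict_ne_zero hf h)).trans
    (natDegree_restrict_le_of_tangent_eq_zero hf hu hw)

/-- A line that touches the curve at two of its points has few zeros in common with it. -/
theorem lineZeros_le_of_bitangent (hn : NoLinearFactor f) (hf : f.IsHomogeneous (d + 3))
    {u w : Fin 3 → F} (h : LinearIndependent F ![u, w]) (hu : MvPolynomial.aeval u f = 0)
    (huw : tangent f u w = 0) (hw : MvPolynomial.aeval w f = 0) (hwu : tangent f w u = 0) :
    lineZeros f u w ≤ d := by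
  classical
  have h0 := hn.restrict_ne_zero hf h
  have hdeg := natDegree_restrict_le_of_tangent_eq_zero hf hu huw
  obtain ⟨k, hk⟩ : Polynomial.X ^ 2 ∣ restrict f w u := by
    rw [Polynomial.X_pow_dvd_iff]
    intro i hi
    interval_cases i
    · rw [coeff_zero_restrict, hw]
    · rw [coeff_one_restrict, hwu]
  have hk0 : k ≠ 0 := by rintro rfl; exact h0 (by simpa using hk)
  -- `X * k` has the same roots as `X ^ 2 * k`, counted without multiplicity, and degree one less:
  -- tangency at `w` saves one zero on top of the two saved at `u`.
  have hXk : Polynomial.X * k ≠ 0 := mul_ne_zero Polynomial.X_ne_zero hk0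
  have h2 : {t : F | MvPolynomial.aeval (w + t • u) f = 0} =
      ↑(Polynomial.X * k).roots.toFinset := by
    ext t
    simp [hXk, Polynomial.IsRoot, ← eval_restrict, hk]
  rw [lineZeros, h2, Set.ncard_coe_finset]
  refine (Multiset.toFinset_card_le _).trans ((Polynomial.card_roots' _).trans ?_)
  rw [hk, Polynomial.natDegree_X_pow_mul _ hk0] at hdeg
  rw [Polynomial.natDegree_X_mul hk0]
  omega

theorem lineZeros_comm (hf : f.IsHomogeneous d) {u w : Fin 3 → F}
    (hu : MvPolynomial.aeval u f = 0) (hw : MvPolynomial.aeval w f = 0) :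
    lineZeros f u w = lineZeros f w u := by
  have key : ∀ {u w : Fin 3 → F}, MvPolynomial.aeval u f = 0 → ∀ t : F,
      MvPolynomial.aeval (w + t • u) f = 0 → MvPolynomial.aeval (u + t⁻¹ • w) f = 0 := by
    intro u w hu t ht
    by_cases h : t = 0
    · simpa [h] using hu
    · rw [← aeval_smul_eq_zero_iff hf h]
      rwa [smul_add, smul_smul, mul_inv_cancel₀ h, one_smul, add_comm]
  -- The convention `0⁻¹ = 0` matches the point `w`, counted on the left only, with the point `u`,
  -- counted on the right only.
  refine Set.ncard_congr (fun t _ => t⁻¹) (fun t ht => key hu t ht)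
    (fun s t _ _ h => inv_injective h) fun t ht => ⟨t⁻¹, key hw t ht, inv_inv t⟩

theorem lineZeros_add_smul (f : MvPolynomial (Fin 3) F) (u w : Fin 3 → F) (s : F) :
    lineZeros f u (w + s • u) = lineZeros f u w := by
  refine Set.ncard_congr (fun t _ => s + t) (fun t ht => ?_) (fun a b _ _ h => by simpa using h)
    fun t ht => ⟨t - s, ?_, by ring⟩
  · simpa [add_smul, add_assoc] using ht
  · simpa [add_assoc, ← add_smul] using ht

end

/-- Directions of the lines through a point that spans a complement of `e₁` and `e₂`. -/
def pencil {F : Type*} [Field F] (e₁ e₂ : Fin 3 → F) : Option F → Fin 3 → F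
  | none => e₁
  | some c => e₂ + c • e₁

/-- Representatives of the points of the plane, sorted by the lines of a pencil with centre `u`. -/
def pencilVec {F : Type*} [Field F] (u e₁ e₂ : Fin 3 → F) : Option (Option F × F) → Fin 3 → F
  | none => u
  | some x => pencil e₁ e₂ x.1 + x.2 • u

/-! ### Counting points along a pencil of lines -/

section
variable {F : Type*} [Field F] {f : MvPolynomial (Fin 3) F} {d : ℕ} {u e₁ e₂ : Fin 3 → F}

theorem eq_zero_of_triple (h : LinearIndependent F ![u, e₁, e₂]) {a b c : F}
    (h0 : a • u + b • e₁ + c • e₂ = 0) : a = 0 ∧ b = 0 ∧ c = 0 := by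
  have := Fintype.linearIndependent_iff.mp h ![a, b, c] (by simpa [Fin.sum_univ_three] using h0)
  exact ⟨this 0, this 1, this 2⟩

theorem eq_of_triple (h : LinearIndependent F ![u, e₁, e₂]) {a b c a' b' c' : F}
    (h0 : a • u + b • e₁ + c • e₂ = a' • u + b' • e₁ + c' • e₂) : a = a' ∧ b = b' ∧ c = c' := by
  have := eq_zero_of_triple h (a := a - a') (b := b - b') (c := c - c') (by
    rw [sub_smul, sub_smul, sub_smul]
    linear_combination (exp := 1) h0)
  simpa [sub_eq_zero] using this

theorem exists_of_triple (h : LinearIndependent F ![u, e₁, e₂]) (v : Fin 3 → F) :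
    ∃ a b c : F, v = a • u + b • e₁ + c • e₂ := by
  let B := basisOfLinearIndependentOfCardEqFinrank h (by simp)
  have hB : ⇑B = ![u, e₁, e₂] := coe_basisOfLinearIndependentOfCardEqFinrank h _
  refine ⟨B.repr v 0, B.repr v 1, B.repr v 2, ?_⟩
  have := B.sum_repr v
  rw [hB, Fin.sum_univ_three] at this
  exact this.symm

/-- Coordinates of a representative with respect to `u`, `e₁`, `e₂`. -/
theorem smul_pencil_add_smul (k : Option F) (a t : F) :
    a • (pencil e₁ e₂ k + t • u) =
      (a * t) • u + (a * k.elim 1 id) • e₁ + (a * k.elim 0 1) • e₂ := by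
  cases k with
  | none => simp [pencil, smul_smul, add_comm]
  | some c => simp [pencil, smul_smul]; abel

theorem linearIndependent_pencil (h : LinearIndependent F ![u, e₁, e₂]) (k : Option F) :
    LinearIndependent F ![u, pencil e₁ e₂ k] := by
  rw [LinearIndependent.pair_iff]
  intro s t h0
  cases k with
  | none =>
    have := eq_zero_of_triple h (a := s) (b := t) (c := 0) (by simpa [pencil] using h0)
    exact ⟨this.1, this.2.1⟩
  | some c =>
    have := eq_zero_of_triple h (a := s) (b := t * c) (c := t) (by
      rw [← h0, pencil, smul_add, smul_smul]; abel)
    exact ⟨this.1, this.2.2⟩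

theorem pencilVec_ne_zero (h : LinearIndependent F ![u, e₁, e₂]) (x : Option (Option F × F)) :
    pencilVec u e₁ e₂ x ≠ 0 := by
  intro h0
  cases x with
  | none =>
    have := eq_zero_of_triple h (a := 1) (b := 0) (c := 0) (by simpa [pencilVec] using h0)
    exact one_ne_zero this.1
  | some x =>
    have := LinearIndependent.pair_iff.mp (linearIndependent_pencil h x.1) x.2 1 (by
      rw [one_smul, add_comm]; exact h0)
    exact one_ne_zero this.2

theorem pencilVec_injective (h : LinearIndependent F ![u, e₁, e₂]) {x y : Option (Option F × F)}
    {a : F} (hxy : a • pencilVec u e₁ e₂ y = pencilVec u e₁ e₂ x) : x = y := by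
  rcases x with _ | ⟨k, t⟩ <;> rcases y with _ | ⟨l, s⟩
  · rfl
  · have h1 := smul_pencil_add_smul (e₁ := e₁) (e₂ := e₂) (u := u) l a s
    have := eq_of_triple h (a := a * s) (b := a * l.elim 1 id) (c := a * l.elim 0 1)
      (a' := 1) (b' := 0) (c' := 0) (by rw [← h1]; simpa [pencilVec] using hxy)
    clear h1 hxy h
    cases l <;> simp at this <;> grind
  · have h1 := smul_pencil_add_smul (e₁ := e₁) (e₂ := e₂) (u := u) k 1 t
    have := eq_of_triple h (a := 1 * t) (b := 1 * k.elim 1 id) (c := 1 * k.elim 0 1)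
      (a' := a) (b' := 0) (c' := 0) (by rw [← h1]; simpa [pencilVec] using hxy.symm)
    clear h1 hxy h
    cases k <;> simp_all
  · have h1 := smul_pencil_add_smul (e₁ := e₁) (e₂ := e₂) (u := u) k 1 t
    have h2 := smul_pencil_add_smul (e₁ := e₁) (e₂ := e₂) (u := u) l a s
    have := eq_of_triple h (h2.symm.trans ((hxy.trans (one_smul F _).symm).trans h1))
    clear h1 h2 hxy h
    cases k <;> cases l <;> simp at this <;> grind

theorem exists_smul_pencilVec (h : LinearIndependent F ![u, e₁, e₂]) {v : Fin 3 → F} (hv : v ≠ 0) :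
    ∃ x, ∃ a : F, a • pencilVec u e₁ e₂ x = v := by
  obtain ⟨a, b, c, rfl⟩ := exists_of_triple h v
  by_cases hc : c = 0
  · by_cases hb : b = 0
    · exact ⟨none, a, by simp [pencilVec, hb, hc]⟩
    · refine ⟨some (none, b⁻¹ * a), b, ?_⟩
      rw [pencilVec, smul_pencil_add_smul]
      simp [hc, hb]
  · refine ⟨some (some (c⁻¹ * b), c⁻¹ * a), c, ?_⟩
    rw [pencilVec, smul_pencil_add_smul]
    simp [hc]

/-- Every rational point other than the centre `u` lies on exactly one line of the pencil, so
`pencilVec` enumerates the plane without repetition. -/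
theorem ncard_rationalPoints [Fintype F] (hf : f.IsHomogeneous d)
    (h : LinearIndependent F ![u, e₁, e₂]) [Decidable (MvPolynomial.aeval u f = 0)] :
    (rationalPoints f).ncard = (if MvPolynomial.aeval u f = 0 then 1 else 0) +
      ∑ k, lineZeros f u (pencil e₁ e₂ k) := by
  classical
  let φ : Option (Option F × F) → Plane F := fun x =>
    Projectivization.mk F (pencilVec u e₁ e₂ x) (pencilVec_ne_zero h x)
  have hφ : Function.Bijective φ := by
    constructor
    · intro x y hxy
      obtain ⟨a, ha⟩ := (Projectivization.mk_eq_mk_iff' _ _ _ _ _).mp hxy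
      exact pencilVec_injective h ha
    · intro p
      obtain ⟨x, a, hx⟩ := exists_smul_pencilVec h p.rep_nonzero
      refine ⟨x, ?_⟩
      rw [← p.mk_rep]
      exact ((Projectivization.mk_eq_mk_iff' _ _ _ _ _).mpr ⟨a, hx⟩).symm
  have h1 : rationalPoints f =
      φ '' {x | MvPolynomial.aeval (pencilVec u e₁ e₂ x) f = 0} := by
    ext p
    obtain ⟨x, rfl⟩ := hφ.2 p
    rw [hφ.1.mem_set_image]
    exact vanishesAt_mk_iff hf _ _
  have h2 : {x | MvPolynomial.aeval (pencilVec u e₁ e₂ x) f = 0} =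
      ↑(Finset.univ.filter fun x => MvPolynomial.aeval (pencilVec u e₁ e₂ x) f = 0) := by
    simp only [Finset.coe_filter, Finset.mem_univ, true_and]
  rw [h1, Set.ncard_image_of_injective _ hφ.1, h2, Set.ncard_coe_finset, Finset.card_filter,
    Fintype.sum_option, Fintype.sum_prod_type]
  congr 1
  · exact if_congr Iff.rfl rfl rfl
  · refine Finset.sum_congr rfl fun k _ => ?_
    rw [← Finset.card_filter, ← Set.ncard_coe_finset, lineZeros]
    refine congrArg Set.ncard (Set.ext fun t => ?_)
    rw [Finset.mem_coe, Finset.mem_filter]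
    exact ⟨fun h => h.2, fun h => ⟨Finset.mem_univ _, h⟩⟩

theorem exists_map_pencil_eq_zero (L : (Fin 3 → F) →ₗ[F] F) (e₁ e₂ : Fin 3 → F) :
    ∃ k, L (pencil e₁ e₂ k) = 0 := by
  by_cases h : L e₁ = 0
  · exact ⟨none, h⟩
  · exact ⟨some (-(L e₂ / L e₁)), by simp [pencil, h]⟩

/-- Any two members of the pencil span the same plane as `e₁` and `e₂`. -/
theorem map_pencil_eq_zero {L : (Fin 3 → F) →ₗ[F] F} {k l : Option F} (hkl : k ≠ l)
    (hk : L (pencil e₁ e₂ k) = 0) (hl : L (pencil e₁ e₂ l) = 0) : L e₁ = 0 ∧ L e₂ = 0 := by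
  rcases k with _ | k <;> rcases l with _ | l
  · exact absurd rfl hkl
  · simp_all [pencil]
  · simp_all [pencil]
  · simp only [pencil, map_add, map_smul, smul_eq_mul] at hk hl
    have h1 : (k - l) * L e₁ = 0 := by linear_combination hk - hl
    have h2 : L e₁ = 0 := by
      refine (mul_eq_zero.mp h1).resolve_left fun h => hkl ?_
      rw [sub_eq_zero.mp h]
    exact ⟨h2, by simpa [h2] using hk⟩

end

/-! ### Segre's bound and conics -/

section
variable {F : Type*} [Field F] {f : MvPolynomial (Fin 3) F} {d : ℕ}

theorem exists_linearIndependent_pair {u : Fin 3 → F} (hu : u ≠ 0) :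
    ∃ w, LinearIndependent F ![u, w] := by
  have h : LinearIndependent F ![u] := by simpa using hu
  obtain ⟨e, he⟩ := exists_linearIndependent_snoc_of_lt_finrank (R := F) h (by simp)
  have : (Fin.snoc ![u] e : Fin 2 → Fin 3 → F) = ![u, e] := by
    funext i
    fin_cases i <;> rfl
  exact ⟨e, this ▸ he⟩

theorem exists_linearIndependent_tangent_eq_zero (f : MvPolynomial (Fin 3) F) {u : Fin 3 → F}
    (hu : u ≠ 0) : ∃ w, LinearIndependent F ![u, w] ∧ tangent f u w = 0 := by
  obtain ⟨w, hw⟩ := exists_linearIndependent_pair hu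
  obtain ⟨e, he⟩ := exists_linearIndependent_triple hw
  obtain ⟨k, hk⟩ := exists_map_pencil_eq_zero (tangent f u) w e
  exact ⟨_, linearIndependent_pencil he k, hk⟩

/-- The restriction is a polynomial of degree exactly one, whose root is the second intersection
point. -/
theorem one_le_lineZeros [Finite F] (hf : f.IsHomogeneous 2) {u w : Fin 3 → F}
    (hu : MvPolynomial.aeval u f = 0) (hw : tangent f u w ≠ 0) : 1 ≤ lineZeros f u w := by
  have h1 : (restrict f w u).coeff 1 = tangent f u w := by
    rw [← coeff_one_restrict, ← coeff_restrict_comm hf w u (k := 1) (by norm_num)]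
  have h2 := Polynomial.eq_X_add_C_of_natDegree_le_one
    (natDegree_restrict_le_of_aeval_eq_zero hf hu w)
  refine (Set.ncard_pos (Set.toFinite _)).mpr
    ⟨-((restrict f w u).coeff 0 / (restrict f w u).coeff 1), ?_⟩
  change MvPolynomial.aeval _ f = 0
  rw [← h1] at hw
  have h3 : ∀ t, (restrict f w u).eval t =
      (restrict f w u).coeff 1 * t + (restrict f w u).coeff 0 := by
    intro t
    conv_lhs => rw [h2]
    simp
  rw [← eval_restrict, h3]
  field_simp
  ring

variable [Fintype F]

theorem exists_zero_of_ncard_pos (h : 0 < (rationalPoints f).ncard) :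
    ∃ u : Fin 3 → F, u ≠ 0 ∧ MvPolynomial.aeval u f = 0 := by
  obtain ⟨x, hx⟩ := (Set.ncard_pos).mp h
  exact ⟨x.rep, x.rep_nonzero, hx⟩

theorem ncard_rationalPoints_le_add_lineZeros (hn : NoLinearFactor f)
    (hf : f.IsHomogeneous (d + 2)) {u w : Fin 3 → F} (h : LinearIndependent F ![u, w])
    (hu : MvPolynomial.aeval u f = 0) :
    (rationalPoints f).ncard ≤ 1 + lineZeros f u w + Fintype.card F * (d + 1) := by
  classical
  obtain ⟨e, he⟩ := exists_linearIndependent_triple h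
  rw [ncard_rationalPoints hf he, if_pos hu, Fintype.sum_option, ← add_assoc]
  refine Nat.add_le_add_left ?_ _
  rw [← smul_eq_mul, ← Finset.card_univ]
  exact Finset.sum_le_card_nsmul _ _ _ fun c _ =>
    lineZeros_le_of_aeval_eq_zero hn hf (linearIndependent_pencil he _) hu

/-- The pencil contains a line tangent at `u`, and it is not the one through `w`. The zero it saves
makes up for the point `u` itself. -/
theorem ncard_rationalPoints_le_of_tangent_ne_zero (hn : NoLinearFactor f)
    (hf : f.IsHomogeneous (d + 2)) {u w : Fin 3 → F} (h : LinearIndependent F ![u, w])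
    (hu : MvPolynomial.aeval u f = 0) (hw : tangent f u w ≠ 0) :
    (rationalPoints f).ncard ≤ lineZeros f u w + Fintype.card F * (d + 1) := by
  classical
  obtain ⟨e, he⟩ := exists_linearIndependent_triple h
  obtain ⟨k, hk⟩ := exists_map_pencil_eq_zero (tangent f u) w e
  obtain ⟨c, rfl⟩ : ∃ c, k = some c := by
    cases k with
    | none => exact absurd hk hw
    | some c => exact ⟨c, rfl⟩
  rw [ncard_rationalPoints hf he, if_pos hu, Fintype.sum_option]
  have : ∑ i : F, lineZeros f u (pencil w e (some i)) < ∑ _i : F, (d + 1) := by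
    refine Finset.sum_lt_sum (fun c _ =>
      lineZeros_le_of_aeval_eq_zero hn hf (linearIndependent_pencil he _) hu)
      ⟨c, Finset.mem_univ _, Nat.lt_succ_of_le ?_⟩
    exact lineZeros_le_of_tangent_eq_zero hn hf (linearIndependent_pencil he _) hu hk
  rw [Finset.sum_const, smul_eq_mul, Finset.card_univ] at this
  change 1 + (lineZeros f u w + _) ≤ _
  omega

/-- Segre's bound for the number of rational points of a plane curve without linear components. -/
theorem ncard_rationalPoints_le (hn : NoLinearFactor f) (hf : f.IsHomogeneous (d + 2)) :
    (rationalPoints f).ncard ≤ (d + 1) * (Fintype.card F + 1) := by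
  rcases Nat.eq_zero_or_pos (rationalPoints f).ncard with h | h
  · rw [h]; exact Nat.zero_le _
  · obtain ⟨u, hu, hu'⟩ := exists_zero_of_ncard_pos h
    obtain ⟨w, hw, ht⟩ := exists_linearIndependent_tangent_eq_zero f hu
    have h1 := ncard_rationalPoints_le_add_lineZeros hn hf hw hu'
    have h2 := lineZeros_le_of_tangent_eq_zero hn hf hw hu' ht
    nlinarith

/-- For degree at least three, Segre's bound is not attained. -/
theorem ncard_rationalPoints_lt (hn : NoLinearFactor f) (hf : f.IsHomogeneous (d + 3)) :
    (rationalPoints f).ncard < (d + 2) * (Fintype.card F + 1) := by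
  by_contra! hN
  obtain ⟨u, hu, hu'⟩ := exists_zero_of_ncard_pos (f := f) (lt_of_lt_of_le (by positivity) hN)
  obtain ⟨w, hw, ht⟩ := exists_linearIndependent_tangent_eq_zero f hu
  have h1 := ncard_rationalPoints_le_add_lineZeros hn hf hw hu'
  -- Reaching Segre's bound forces the chosen tangent at `u` to carry `d + 1 > 0` further points;
  -- `v` will be one of them.
  have h2 : d + 1 ≤ lineZeros f u w := by nlinarith
  obtain ⟨t, ht'⟩ : {t : F | MvPolynomial.aeval (w + t • u) f = 0}.Nonempty :=
    Set.nonempty_of_ncard_ne_zero (by rw [lineZeros] at h2; omega)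
  rw [← lineZeros_add_smul f u w t] at h2
  set v := w + t • u with hv
  have hv' : MvPolynomial.aeval v f = 0 := ht'
  have huv : LinearIndependent F ![u, v] := by
    rw [LinearIndependent.pair_iff] at hw ⊢
    intro a b hab
    have := hw (a + b * t) b (by rw [← hab, hv, smul_add, smul_smul, add_smul]; abel)
    obtain ⟨h3, rfl⟩ := this
    simpa using h3
  have hvu : LinearIndependent F ![v, u] := by
    rw [LinearIndependent.pair_iff] at huv ⊢
    intro a b hab
    exact (huv b a (by rw [add_comm]; exact hab)).symm
  have htv : tangent f u v = 0 := by
    rw [hv, map_add, map_smul, ht, tangent_self hf hu']; simp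
  have h3 : lineZeros f u v ≤ d + 1 := lineZeros_le_of_tangent_eq_zero hn hf huv hu' htv
  rw [lineZeros_comm hf hu' hv'] at h2 h3
  -- Otherwise counting from `v` gives at most `(d + 1) + q (d + 2)` points, one short of the bound.
  -- So the line touches the curve at `u` and at `v`, leaving room for only `d` points besides `v`.
  have htu : tangent f v u = 0 := by
    by_contra htu
    have := ncard_rationalPoints_le_of_tangent_ne_zero hn hf hvu hv' htu
    nlinarith
  have := lineZeros_le_of_bitangent hn hf hvu hv' htu hu' htv
  omega

/-- A conic without linear components and with two rational points has `q + 1` rational points. -/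
theorem ncard_rationalPoints_conic (hn : NoLinearFactor f) (hf : f.IsHomogeneous 2)
    (h2 : 2 ≤ (rationalPoints f).ncard) : (rationalPoints f).ncard = Fintype.card F + 1 := by
  classical
  refine le_antisymm (by simpa using ncard_rationalPoints_le (d := 0) hn hf) ?_
  obtain ⟨u, hu, hu'⟩ := exists_zero_of_ncard_pos (f := f) (by omega)
  obtain ⟨e₁, h1⟩ := exists_linearIndependent_pair hu
  obtain ⟨e₂, he⟩ := exists_linearIndependent_triple h1
  have hN := ncard_rationalPoints hf he
  rw [if_pos hu'] at hN
  obtain ⟨k, hk⟩ := exists_map_pencil_eq_zero (tangent f u) e₁ e₂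
  -- Two tangent lines at `u` would make every line of the pencil tangent; then no line has a
  -- further zero, and `u` is the only rational point.
  have hne : ∀ l, l ≠ k → tangent f u (pencil e₁ e₂ l) ≠ 0 := by
    intro l hl hl0
    obtain ⟨h3, h4⟩ := map_pencil_eq_zero hl hl0 hk
    have : ∑ l, lineZeros f u (pencil e₁ e₂ l) = 0 := by
      refine Finset.sum_eq_zero fun l _ => Nat.le_zero.mp ?_
      refine lineZeros_le_of_tangent_eq_zero (d := 0) hn hf (linearIndependent_pencil he l) hu' ?_
      cases l <;> simp [pencil, h3, h4]
    omega
  have h5 : ∑ _l ∈ Finset.univ.erase k, 1 ≤ ∑ l, lineZeros f u (pencil e₁ e₂ l) :=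
    (Finset.sum_le_sum fun l hl =>
      one_le_lineZeros hf hu' (hne l (Finset.ne_of_mem_erase hl))).trans
      (Finset.sum_le_sum_of_subset (Finset.erase_subset _ _))
  rw [Finset.sum_const, Finset.card_erase_of_mem (Finset.mem_univ _), Finset.card_univ,
    Fintype.card_option] at h5
  simp only [smul_eq_mul, mul_one] at h5
  omega

end

/-- The linear functional `v ↦ ∑ aᵢ vᵢ`. -/
noncomputable def linFun {F : Type*} [Field F] (a : Fin 3 → F) : (Fin 3 → F) →ₗ[F] F :=
  ∑ i, a i • LinearMap.proj i

/-! ### Lines in a pencil and the upper bound for quartics -/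

section
variable {F : Type*} [Field F] {f : MvPolynomial (Fin 3) F} {d : ℕ} {u e₁ e₂ : Fin 3 → F}

theorem linFun_apply (a v : Fin 3 → F) : linFun a v = ∑ i, a i * v i := by
  simp [linFun]

theorem linFun_comm (a v : Fin 3 → F) : linFun a v = linFun v a := by
  rw [linFun_apply, linFun_apply]
  exact Finset.sum_congr rfl fun i _ => mul_comm _ _

theorem aeval_linForm_eq_linFun (a v : Fin 3 → F) :
    MvPolynomial.aeval v (linForm a) = linFun a v := by
  rw [aeval_linForm_eq_dot, linFun_apply]

theorem exists_linFun_eq_zero (a b : Fin 3 → F) :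
    ∃ u, u ≠ 0 ∧ linFun a u = 0 ∧ linFun b u = 0 := by
  obtain ⟨u, hu, h0⟩ := Submodule.exists_mem_ne_zero_of_ne_bot
    (LinearMap.ker_ne_bot_of_finrank_lt (f := (linFun a).prod (linFun b)) (by simp))
  have : (linFun a u, linFun b u) = 0 := hu
  exact ⟨u, h0, congrArg Prod.fst this, congrArg Prod.snd this⟩

theorem exists_linFun_pencil_iff (h : LinearIndependent F ![u, e₁, e₂]) {a : Fin 3 → F}
    (ha : a ≠ 0) (hu : linFun a u = 0) : ∃ k₀, ∀ k, linFun a (pencil e₁ e₂ k) = 0 ↔ k = k₀ := by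
  obtain ⟨k₀, hk₀⟩ := exists_map_pencil_eq_zero (linFun a) e₁ e₂
  refine ⟨k₀, fun k => ⟨fun hk => ?_, fun hk => hk ▸ hk₀⟩⟩
  by_contra hne
  obtain ⟨h1, h2⟩ := map_pencil_eq_zero hne hk hk₀
  apply ha
  ext i
  obtain ⟨r, s, t, hv⟩ := exists_of_triple h (Pi.single i 1)
  have h3 := congrArg (linFun a) hv
  simp only [map_add, map_smul, hu, h1, h2, smul_zero, add_zero] at h3
  simpa [linFun_apply, Pi.single_apply] using h3

theorem exists_triple {u : Fin 3 → F} (hu : u ≠ 0) :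
    ∃ e₁ e₂, LinearIndependent F ![u, e₁, e₂] := by
  obtain ⟨e₁, h⟩ := exists_linearIndependent_pair hu
  obtain ⟨e₂, h'⟩ := exists_linearIndependent_triple h
  exact ⟨e₁, e₂, h'⟩

theorem rationalPoints_mul (f g : MvPolynomial (Fin 3) F) :
    rationalPoints (f * g) = rationalPoints f ∪ rationalPoints g := by
  ext x
  change MvPolynomial.aeval x.rep (f * g) = 0 ↔
    MvPolynomial.aeval x.rep f = 0 ∨ MvPolynomial.aeval x.rep g = 0
  rw [map_mul, mul_eq_zero]

theorem aeval_pencil_linForm {a : Fin 3 → F} (hu : linFun a u = 0) (w : Fin 3 → F) (t : F) :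
    MvPolynomial.aeval (w + t • u) (linForm a) = linFun a w := by
  rw [aeval_linForm_eq_linFun, map_add, map_smul, hu, smul_zero, add_zero]

theorem lineZeros_mul_linForm_of_ne_zero {a : Fin 3 → F} (hu : linFun a u = 0) {w : Fin 3 → F}
    (hw : linFun a w ≠ 0) (f : MvPolynomial (Fin 3) F) :
    lineZeros (f * linForm a) u w = lineZeros f u w := by
  simp only [lineZeros, map_mul, aeval_pencil_linForm hu, mul_eq_zero, hw, or_false]

theorem lineZeros_mul_linForm_of_eq_zero [Fintype F] {a : Fin 3 → F} (hu : linFun a u = 0)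
    {w : Fin 3 → F} (hw : linFun a w = 0) (f : MvPolynomial (Fin 3) F) :
    lineZeros (f * linForm a) u w = Fintype.card F := by
  simp only [lineZeros, map_mul, aeval_pencil_linForm hu, hw, mul_zero, Set.ofPred_true,
    Set.ncard_univ, Nat.card_eq_fintype_card]

theorem lineZeros_le_card [Fintype F] (f : MvPolynomial (Fin 3) F) (u w : Fin 3 → F) :
    lineZeros f u w ≤ Fintype.card F := by
  rw [← Nat.card_eq_fintype_card, ← Set.ncard_univ]
  exact Set.ncard_le_ncard (Set.subset_univ _)

/-- A conic through a point outside all rational lines has no linear factor. -/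
theorem noLinearFactor_of_isHomogeneous_two {A : Type*} [Field A] [Algebra F A] {v : Fin 3 → A}
    (hv : ∀ l : MvPolynomial (Fin 3) F, IsCurveEquation 1 l → MvPolynomial.aeval v l ≠ 0)
    (hf0 : f ≠ 0) (hf : f.IsHomogeneous 2) (hfv : MvPolynomial.aeval v f = 0) :
    NoLinearFactor f := by
  rintro a ha ⟨g, rfl⟩
  rw [map_mul, mul_eq_zero] at hfv
  exact hfv.elim (hv _ (isCurveEquation_linForm ha))
    (hv g ⟨right_ne_zero_of_mul hf0, isHomogeneous_of_linForm_mul ha hf⟩)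

variable [Fintype F]

theorem sum_lineZeros_mul_linForm_le (h : LinearIndependent F ![u, e₁, e₂]) {a : Fin 3 → F}
    (ha : a ≠ 0) (hu : linFun a u = 0) (f : MvPolynomial (Fin 3) F) :
    ∑ k, lineZeros (f * linForm a) u (pencil e₁ e₂ k) ≤
      Fintype.card F + ∑ k, lineZeros f u (pencil e₁ e₂ k) := by
  classical
  obtain ⟨k₀, hk₀⟩ := exists_linFun_pencil_iff h ha hu
  rw [← Finset.add_sum_erase _ _ (Finset.mem_univ k₀)]
  refine add_le_add (lineZeros_le_card _ _ _) ((Finset.sum_le_sum fun k hk => ?_).trans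
    (Finset.sum_le_sum_of_subset (Finset.erase_subset k₀ _)))
  exact (lineZeros_mul_linForm_of_ne_zero hu
    (fun h => Finset.ne_of_mem_erase hk ((hk₀ k).mp h)) f).le

theorem sum_lineZeros_mul_linForm (h : LinearIndependent F ![u, e₁, e₂]) {a : Fin 3 → F}
    (ha : a ≠ 0) (hu : linFun a u = 0) {f : MvPolynomial (Fin 3) F} {k₀ : Option F}
    (hk₀ : linFun a (pencil e₁ e₂ k₀) = 0) (hf : lineZeros f u (pencil e₁ e₂ k₀) = 0) :
    ∑ k, lineZeros (f * linForm a) u (pencil e₁ e₂ k) =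
      Fintype.card F + ∑ k, lineZeros f u (pencil e₁ e₂ k) := by
  classical
  obtain ⟨k₁, hk₁⟩ := exists_linFun_pencil_iff h ha hu
  obtain rfl := (hk₁ k₀).mp hk₀
  rw [← Finset.add_sum_erase _ _ (Finset.mem_univ k₀),
    ← Finset.add_sum_erase _ (fun k => lineZeros f u (pencil e₁ e₂ k)) (Finset.mem_univ k₀), hf,
    zero_add, lineZeros_mul_linForm_of_eq_zero hu hk₀]
  congr 1
  exact Finset.sum_congr rfl fun k hk => lineZeros_mul_linForm_of_ne_zero hu
    (fun h => Finset.ne_of_mem_erase hk ((hk₁ k).mp h)) f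

theorem ncard_rationalPoints_linForm_le {a : Fin 3 → F} (ha : a ≠ 0) :
    (rationalPoints (linForm a)).ncard ≤ Fintype.card F + 1 := by
  classical
  obtain ⟨u, hu, hau, -⟩ := exists_linFun_eq_zero a a
  obtain ⟨e₁, e₂, h⟩ := exists_triple hu
  rw [ncard_rationalPoints (isHomogeneous_linForm a) h]
  -- The line is treated as its product with the form `1`, which has no zeros.
  have h1 := sum_lineZeros_mul_linForm_le h ha hau 1
  have h2 : ∀ w, lineZeros (1 : MvPolynomial (Fin 3) F) u w = 0 := by
    intro w
    simp [lineZeros]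
  simp only [one_mul, h2, Finset.sum_const_zero, add_zero] at h1
  split_ifs <;> omega

theorem ncard_rationalPoints_linForm_mul_linForm_le {a b : Fin 3 → F} (ha : a ≠ 0) (hb : b ≠ 0) :
    (rationalPoints (linForm a * linForm b)).ncard ≤ 2 * Fintype.card F + 1 := by
  classical
  -- Centring the pencil at a common point of the two lines counts that point only once.
  obtain ⟨u, hu, hau, hbu⟩ := exists_linFun_eq_zero a b
  obtain ⟨e₁, e₂, h⟩ := exists_triple hu
  have h1 := sum_lineZeros_mul_linForm_le h hb hbu (linForm a)
  have h2 := ncard_rationalPoints (isHomogeneous_linForm a) h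
  rw [aeval_linForm_eq_linFun, if_pos hau] at h2
  have h3 := ncard_rationalPoints_linForm_le ha
  rw [ncard_rationalPoints ((isHomogeneous_linForm a).mul (isHomogeneous_linForm b)) h]
  split_ifs <;> omega

/-- A quartic through a point outside all rational lines has at most `3 q + 2` rational points. -/
theorem ncard_rationalPoints_quartic_le {A : Type*} [Field A] [Algebra F A] {v : Fin 3 → A}
    (hv : ∀ l : MvPolynomial (Fin 3) F, IsCurveEquation 1 l → MvPolynomial.aeval v l ≠ 0)
    (hf0 : f ≠ 0) (hf : f.IsHomogeneous 4) (hfv : MvPolynomial.aeval v f = 0) :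
    (rationalPoints f).ncard ≤ 3 * Fintype.card F + 2 := by
  by_cases hn : NoLinearFactor f
  · have := ncard_rationalPoints_lt (d := 1) hn hf
    omega
  simp only [NoLinearFactor, not_forall, not_not] at hn
  obtain ⟨a, ha, g, rfl⟩ := hn
  have hg := isHomogeneous_of_linForm_mul ha hf
  have hg0 := right_ne_zero_of_mul hf0
  rw [map_mul, mul_eq_zero] at hfv
  replace hfv := hfv.resolve_left (hv _ (isCurveEquation_linForm ha))
  by_cases hn : NoLinearFactor g
  · have h1 := ncard_rationalPoints_lt (d := 0) hn hg
    have h2 := ncard_rationalPoints_linForm_le ha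
    have h3 := Set.ncard_union_le (rationalPoints (linForm a)) (rationalPoints g)
    rw [rationalPoints_mul]
    omega
  simp only [NoLinearFactor, not_forall, not_not] at hn
  obtain ⟨b, hb, h, rfl⟩ := hn
  have hh := isHomogeneous_of_linForm_mul hb hg
  have hh0 := right_ne_zero_of_mul hg0
  rw [map_mul, mul_eq_zero] at hfv
  replace hfv := hfv.resolve_left (hv _ (isCurveEquation_linForm hb))
  have h1 := ncard_rationalPoints_le (d := 0) (noLinearFactor_of_isHomogeneous_two hv hh0 hh hfv) hh
  have h2 := ncard_rationalPoints_linForm_mul_linForm_le ha hb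
  have h3 := Set.ncard_union_le (rationalPoints (linForm a * linForm b)) (rationalPoints h)
  rw [← mul_assoc, rationalPoints_mul]
  omega

end

/-! ### Lines missing a conic -/

section
variable {F : Type*} [Field F] {f : MvPolynomial (Fin 3) F}

variable [Fintype F]

theorem two_le_lineZeros {u w : Fin 3 → F} {s t : F} (hst : s ≠ t)
    (hs : MvPolynomial.aeval (w + s • u) f = 0) (ht : MvPolynomial.aeval (w + t • u) f = 0) :
    2 ≤ lineZeros f u w := by
  rw [← Set.ncard_pair hst]
  exact Set.ncard_le_ncard (Set.insert_subset hs (Set.singleton_subset_iff.mpr ht))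

/-- A line meets a conic without linear factors in at most two points. -/
theorem aeval_ne_zero_of_conic (hn : NoLinearFactor f) (hf : f.IsHomogeneous 2) {u w : Fin 3 → F}
    (h : LinearIndependent F ![u, w]) (hu : MvPolynomial.aeval u f = 0)
    (hw : MvPolynomial.aeval w f = 0) {a b : F} (ha : a ≠ 0) (hb : b ≠ 0) :
    MvPolynomial.aeval (a • u + b • w) f ≠ 0 := by
  intro h0
  have h1 : a • u + b • w = b • (w + (a / b) • u) := by
    rw [smul_add, smul_smul, mul_div_cancel₀ _ hb, add_comm]
  rw [h1, aeval_smul_eq_zero_iff hf hb] at h0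
  have h2 := two_le_lineZeros (f := f) (u := u) (w := w) (s := 0) (t := a / b)
    (div_ne_zero ha hb).symm (by simpa using hw) h0
  have h3 := lineZeros_le_of_aeval_eq_zero hn hf h hu
  omega

theorem linearIndependent_triple_of_conic (hn : NoLinearFactor f) (hf : f.IsHomogeneous 2)
    {x y z : Fin 3 → F} (hxy : LinearIndependent F ![x, y]) (hxz : LinearIndependent F ![x, z])
    (hyz : LinearIndependent F ![y, z]) (hx : MvPolynomial.aeval x f = 0)
    (hy : MvPolynomial.aeval y f = 0) (hz : MvPolynomial.aeval z f = 0) :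
    LinearIndependent F ![x, y, z] := by
  have key : ∀ a b c : F, a • x + b • y + c • z = 0 → a = 0 ∧ b = 0 ∧ c = 0 := by
    intro a b c h
    have hc : c = 0 := by
      by_contra hc
      by_cases ha : a = 0
      · exact hc (LinearIndependent.pair_iff.mp hyz b c (by simpa [ha] using h)).2
      by_cases hb : b = 0
      · exact hc (LinearIndependent.pair_iff.mp hxz a c (by simpa [hb] using h)).2
      apply aeval_ne_zero_of_conic hn hf hxy hx hy ha hb
      rw [eq_neg_of_add_eq_zero_left h, ← neg_smul, aeval_smul_eq_zero_iff hf (neg_ne_zero.mpr hc)]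
      exact hz
    have := LinearIndependent.pair_iff.mp hxy a b (by simpa [hc] using h)
    exact ⟨this.1, this.2, hc⟩
  refine Fintype.linearIndependent_iff.mpr fun g hg i => ?_
  have := key (g 0) (g 1) (g 2) (by simpa [Fin.sum_univ_three] using hg)
  fin_cases i
  exacts [this.1, this.2.1, this.2.2]

/-- Through a suitable point outside a conic there pass two lines that meet it in two points. -/
theorem exists_center (hn : NoLinearFactor f) (hf : f.IsHomogeneous 2)
    (h4 : 4 ≤ (rationalPoints f).ncard) :
    ∃ u e₁ e₂ : Fin 3 → F, LinearIndependent F ![u, e₁, e₂] ∧ MvPolynomial.aeval u f ≠ 0 ∧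
      2 ≤ lineZeros f u e₁ ∧ 2 ≤ lineZeros f u e₂ := by
  obtain ⟨v, hv, hx⟩ : ∃ v : Fin 4 → Fin 3 → F, (∀ i, MvPolynomial.aeval (v i) f = 0) ∧
      ∀ i j, i ≠ j → LinearIndependent F ![v i, v j] := by
    have : Fintype (rationalPoints f) := Fintype.ofFinite _
    obtain ⟨x⟩ : Nonempty (Fin 4 ↪ rationalPoints f) := by
      refine Function.Embedding.nonempty_of_card_le ?_
      rwa [Fintype.card_fin, ← Nat.card_eq_fintype_card]
    exact ⟨fun i => (x i).1.rep, fun i => (x i).2, fun i j hij =>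
      Projectivization.linearIndependent_pair_iff_ne.mpr fun h =>
        hij (x.injective (Subtype.ext h))⟩
  have ht : ∀ i j k, i ≠ j → i ≠ k → j ≠ k → LinearIndependent F ![v i, v j, v k] :=
    fun i j k hij hik hjk => linearIndependent_triple_of_conic hn hf (hx i j hij) (hx i k hik)
      (hx j k hjk) (hv i) (hv j) (hv k)
  obtain ⟨a, b, c, h⟩ := exists_of_triple (ht 0 1 2 (by decide) (by decide) (by decide)) (v 3)
  have ha : a ≠ 0 := by
    rintro rfl
    refine one_ne_zero (neg_eq_zero.mp (eq_zero_of_triple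
      (ht 1 2 3 (by decide) (by decide) (by decide)) (a := b) (b := c) (c := -1) ?_).2.2)
    rw [h]; module
  have hb : b ≠ 0 := by
    rintro rfl
    refine one_ne_zero (neg_eq_zero.mp (eq_zero_of_triple
      (ht 0 2 3 (by decide) (by decide) (by decide)) (a := a) (b := c) (c := -1) ?_).2.2)
    rw [h]; module
  have hc : c ≠ 0 := by
    rintro rfl
    refine one_ne_zero (neg_eq_zero.mp (eq_zero_of_triple
      (ht 0 1 3 (by decide) (by decide) (by decide)) (a := a) (b := b) (c := -1) ?_).2.2)
    rw [h]; module
  -- Since `v 3 = a v₀ + b v₁ + c v₂`, the vector `a v₀ + b v₁ = v₃ - c v₂` is the intersection of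
  -- the secants `v₀v₁` and `v₂v₃`.
  refine ⟨a • v 0 + b • v 1, v 0, v 2, ?_, aeval_ne_zero_of_conic hn hf (hx 0 1 (by decide))
    (hv 0) (hv 1) ha hb, ?_, ?_⟩
  · refine Fintype.linearIndependent_iff.mpr fun g hg i => ?_
    simp only [Fin.sum_univ_three, Matrix.cons_val] at hg
    have := eq_zero_of_triple (ht 0 1 2 (by decide) (by decide) (by decide))
      (a := g 0 * a + g 1) (b := g 0 * b) (c := g 2) (by rw [← hg]; module)
    have h0 : g 0 = 0 := by simpa [hb] using this.2.1
    fin_cases i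
    exacts [h0, by simpa [h0] using this.1, this.2.2]
  · refine two_le_lineZeros (s := 0) (t := -a⁻¹) (by simp [ha]) (by simpa using hv 0) ?_
    have : v 0 + (-a⁻¹) • (a • v 0 + b • v 1) = (-(a⁻¹ * b)) • v 1 := by
      match_scalars
      · field_simp
        ring
      · field_simp
    rw [this, aeval_smul_eq_zero_iff hf (by simp [ha, hb])]
    exact hv 1
  · refine two_le_lineZeros (s := 0) (t := c⁻¹) (inv_ne_zero hc).symm (by simpa using hv 2) ?_
    have : v 2 + c⁻¹ • (a • v 0 + b • v 1) = c⁻¹ • v 3 := by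
      rw [h]
      match_scalars <;> field_simp
    rw [this, aeval_smul_eq_zero_iff hf (inv_ne_zero hc)]
    exact hv 3

/-- A conic and two lines through a point outside it that do not meet it. -/
theorem exists_ncard_rationalPoints_mul (hq : 3 ≤ Fintype.card F) (hn : NoLinearFactor f)
    (hf : f.IsHomogeneous 2) (h2 : 2 ≤ (rationalPoints f).ncard) :
    ∃ a b : Fin 3 → F, a ≠ 0 ∧ b ≠ 0 ∧
      (rationalPoints (f * linForm a * linForm b)).ncard = 3 * Fintype.card F + 2 := by
  classical
  have hN := ncard_rationalPoints_conic hn hf h2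
  obtain ⟨u, e₁, e₂, he, hu, h3, h4⟩ := exists_center hn hf (by omega)
  have hN' := ncard_rationalPoints hf he
  rw [if_neg hu, zero_add, hN] at hN'
  obtain ⟨k, l, hkl, hk, hl⟩ : ∃ k l, k ≠ l ∧ lineZeros f u (pencil e₁ e₂ k) = 0 ∧
      lineZeros f u (pencil e₁ e₂ l) = 0 := by
    set g : Option F → ℕ := fun k => lineZeros f u (pencil e₁ e₂ k) with hg
    have h3 : 2 ≤ g none := h3
    have h4 : 2 ≤ g (some 0) := by simpa [hg, pencil] using h4
    -- Termwise, `g k + [g k = 0] ≥ 1`, with one unit more on each of the two secants. As `g` sums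
    -- to `q + 1` over `q + 1` lines, at least two values are zero.
    have h5 : ∑ k, (g k + if g k = 0 then 1 else 0) ≥
        ∑ k : Option F, (1 + ((if k = none then 1 else 0) + if k = some 0 then 1 else 0)) := by
      refine Finset.sum_le_sum fun k _ => ?_
      by_cases hk : k = none
      · subst hk
        simp only [if_true, reduceCtorEq, if_false]
        omega
      by_cases hk' : k = some 0
      · subst hk'
        simp only [if_true, reduceCtorEq, if_false]
        omega
      · simp only [hk, hk', if_false]
        split_ifs <;> omega
    simp only [Finset.sum_add_distrib, ← hN', Finset.sum_const, Finset.card_univ,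
      Fintype.card_option, smul_eq_mul, mul_one, Finset.sum_ite_eq', Finset.mem_univ, if_true,
      ← Finset.card_filter] at h5
    obtain ⟨k, hk, l, hl, hkl⟩ := Finset.one_lt_card.mp
      (show 1 < (Finset.univ.filter fun k => g k = 0).card by omega)
    exact ⟨k, l, hkl, (Finset.mem_filter.mp hk).2, (Finset.mem_filter.mp hl).2⟩
  -- By the symmetry of the pairing, the coefficient vector of the line through `u` and the chosen
  -- direction is a vector killed by both.
  obtain ⟨a, ha, hau, hak⟩ := exists_linFun_eq_zero u (pencil e₁ e₂ k)
  obtain ⟨b, hb, hbu, hbl⟩ := exists_linFun_eq_zero u (pencil e₁ e₂ l)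
  rw [linFun_comm] at hau hak hbu hbl
  refine ⟨a, b, ha, hb, ?_⟩
  obtain ⟨k₀, hk₀⟩ := exists_linFun_pencil_iff he ha hau
  have hal : linFun a (pencil e₁ e₂ l) ≠ 0 := fun h =>
    hkl (((hk₀ k).mp hak).trans ((hk₀ l).mp h).symm)
  rw [ncard_rationalPoints ((hf.mul (isHomogeneous_linForm a)).mul (isHomogeneous_linForm b)) he,
    if_pos (by rw [map_mul, aeval_linForm_eq_linFun, hbu, mul_zero]),
    sum_lineZeros_mul_linForm he hb hbu hbl (by
      rw [lineZeros_mul_linForm_of_ne_zero hau hal, hl]),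
    sum_lineZeros_mul_linForm he ha hau hak hk, ← hN']
  ring

end

/-- The conic through `[1 : 0 : 0]` and `[0 : 1 : 0]` with coefficients `c`. -/
noncomputable def conic {F : Type*} [Field F] (c : Fin 4 → F) : MvPolynomial (Fin 3) F :=
  .C (c 0) * (.X 0 * .X 1) + .C (c 1) * (.X 1 * .X 2) + .C (c 2) * (.X 2 * .X 0) +
    .C (c 3) * (.X 2 * .X 2)

/-! ### A conic through the closed point -/

section
variable {F : Type*} [Field F]

theorem isHomogeneous_conic (c : Fin 4 → F) : (conic c).IsHomogeneous 2 := by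
  have h : ∀ (a : F) (i j : Fin 3),
      (MvPolynomial.C a * (MvPolynomial.X i * MvPolynomial.X j)).IsHomogeneous 2 := fun a i j =>
    ((MvPolynomial.isHomogeneous_X F i).mul (MvPolynomial.isHomogeneous_X F j)).C_mul a
  exact (((h _ _ _).add (h _ _ _)).add (h _ _ _)).add (h _ _ _)

theorem aeval_conic {A : Type*} [CommRing A] [Algebra F A] (c : Fin 4 → F) (v : Fin 3 → A) :
    MvPolynomial.aeval v (conic c) = algebraMap F A (c 0) * (v 0 * v 1) +
      algebraMap F A (c 1) * (v 1 * v 2) + algebraMap F A (c 2) * (v 2 * v 0) +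
      algebraMap F A (c 3) * (v 2 * v 2) := by
  simp [conic]

theorem conic_ne_zero {c : Fin 4 → F} (hc : c ≠ 0) : conic c ≠ 0 := by
  intro h
  have h1 : ∀ v : Fin 3 → F, c 0 * (v 0 * v 1) + c 1 * (v 1 * v 2) + c 2 * (v 2 * v 0) +
      c 3 * (v 2 * v 2) = 0 := by
    intro v
    have := aeval_conic c v
    rw [h, map_zero] at this
    exact this.symm
  -- These four points recover the coefficients one after another.
  have h2 := h1 ![1, 1, 0]
  have h3 := h1 ![0, 0, 1]
  have h4 := h1 ![0, 1, 1]
  have h5 := h1 ![1, 0, 1]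
  simp only [Matrix.cons_val, mul_zero, mul_one, add_zero, zero_add] at h2 h3 h4 h5
  rw [h3, add_zero] at h4 h5
  apply hc
  ext i
  fin_cases i
  exacts [h2, h4, h5, h3]

theorem two_le_ncard_rationalPoints_conic [Finite F] (c : Fin 4 → F) :
    2 ≤ (rationalPoints (conic c)).ncard := by
  have h0 : (![1, 0, 0] : Fin 3 → F) ≠ 0 := fun h => one_ne_zero (congrFun h 0)
  have h1 : (![0, 1, 0] : Fin 3 → F) ≠ 0 := fun h => one_ne_zero (congrFun h 1)
  have hne : Projectivization.mk F _ h0 ≠ Projectivization.mk F _ h1 := by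
    intro h
    obtain ⟨a, ha⟩ := (Projectivization.mk_eq_mk_iff' _ _ _ _ _).mp h
    simpa using congrFun ha 0
  rw [← Set.ncard_pair hne]
  refine Set.ncard_le_ncard (Set.insert_subset ?_ (Set.singleton_subset_iff.mpr ?_))
    (Set.toFinite _)
  · refine (vanishesAt_mk_iff (isHomogeneous_conic c) _ h0).mpr ?_
    simp [aeval_conic]
  · refine (vanishesAt_mk_iff (isHomogeneous_conic c) _ h1).mpr ?_
    simp [aeval_conic]

variable [Fintype F]

/-- Pigeonhole: the `q ^ 4` values at `v` are all fixed by the `q ^ 3`-power map, which has at most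
`q ^ 3` fixed points. Two conics agree at `v`, and their difference vanishes there. -/
theorem exists_conic {A : Type*} [Field A] [Algebra F A] {v : Fin 3 → A}
    (hv : ∀ i, v i ^ Fintype.card F ^ 3 = v i) :
    ∃ c : Fin 4 → F, c ≠ 0 ∧ MvPolynomial.aeval v (conic c) = 0 := by
  classical
  have hq : 1 < Fintype.card F ^ 3 := Nat.one_lt_pow (by norm_num) Fintype.one_lt_card
  let τ : A →ₐ[F] A := (FiniteField.frobeniusAlgHom F A) ^ 3
  have hτ : ∀ x, τ x = x ^ Fintype.card F ^ 3 := by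
    intro x
    simp only [τ, pow_succ, pow_zero, one_mul, AlgHom.mul_apply,
      FiniteField.coe_frobeniusAlgHom, ← pow_mul]
  let p : Polynomial A := Polynomial.X ^ Fintype.card F ^ 3 - Polynomial.X
  have hp : p ≠ 0 := FiniteField.X_pow_card_sub_X_ne_zero A hq
  have hmaps : ∀ c ∈ (Finset.univ : Finset (Fin 4 → F)),
      MvPolynomial.aeval v (conic c) ∈ p.roots.toFinset := by
    intro c _
    rw [Multiset.mem_toFinset, Polynomial.mem_roots hp, Polynomial.IsRoot]
    simp only [p, Polynomial.eval_sub, Polynomial.eval_pow, Polynomial.eval_X]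
    rw [← hτ, sub_eq_zero, ← AlgHom.comp_apply, MvPolynomial.comp_aeval]
    congr 2
    ext i
    exact (hτ _).trans (hv i)
  have hcard : p.roots.toFinset.card < (Finset.univ : Finset (Fin 4 → F)).card := by
    refine ((Multiset.toFinset_card_le _).trans (Polynomial.card_roots' _)).trans_lt ?_
    rw [FiniteField.X_pow_card_sub_X_natDegree_eq A hq, Finset.card_univ, Fintype.card_fun,
      Fintype.card_fin]
    exact Nat.pow_lt_pow_right Fintype.one_lt_card (by norm_num)
  obtain ⟨c, -, c', -, hne, h⟩ := Finset.exists_ne_map_eq_of_card_lt_of_maps_to hcard hmaps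
  refine ⟨c - c', sub_ne_zero.mpr hne, ?_⟩
  rw [← sub_eq_zero, aeval_conic, aeval_conic] at h
  rw [aeval_conic, ← h]
  simp only [Pi.sub_apply, map_sub]
  ring

theorem frobenius_mk (v : Fin 3 → AlgebraicClosure F) (hv : v ≠ 0)
    (hv' : (fun i => v i ^ Fintype.card F) ≠ 0) :
    frobenius F (Projectivization.mk _ v hv) = Projectivization.mk _ _ hv' :=
  Projectivization.map_mk _ _ _ _

theorem frobenius_injective : Function.Injective (frobenius F) := by
  intro x y h
  induction x using Projectivization.ind with | h v hv => ?_
  induction y using Projectivization.ind with | h w hw => ?_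
  have hpow : ∀ v : Fin 3 → AlgebraicClosure F, v ≠ 0 → (fun i => v i ^ Fintype.card F) ≠ 0 := by
    intro v hv h
    apply hv
    ext i
    exact eq_zero_of_pow_eq_zero (congrFun h i)
  rw [frobenius_mk v hv (hpow v hv), frobenius_mk w hw (hpow w hw),
    Projectivization.mk_eq_mk_iff'] at h
  obtain ⟨a, ha⟩ := h
  -- The proportionality factor has a `q`-th root, so Frobenius can be cancelled coordinatewise.
  obtain ⟨b, rfl⟩ := IsAlgClosed.exists_pow_nat_eq a (Fintype.card_pos (α := F))
  refine (Projectivization.mk_eq_mk_iff' _ _ _ _ _).mpr ⟨b, ?_⟩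
  ext i
  apply (FiniteField.frobeniusAlgHom F (AlgebraicClosure F)).toRingHom.injective
  have := congrFun ha i
  simpa [mul_pow] using this

theorem vanishesAt_frobenius {f : MvPolynomial (Fin 3) F} {d : ℕ} (hf : f.IsHomogeneous d)
    {p : Plane (AlgebraicClosure F)} (h : VanishesAt f p) : VanishesAt f (frobenius F p) := by
  induction p using Projectivization.ind with | h v hv => ?_
  rw [vanishesAt_mk_iff hf] at h
  refine (vanishesAt_mk_iff hf _ _).mpr ?_
  have := MvPolynomial.comp_aeval v (FiniteField.frobeniusAlgHom F (AlgebraicClosure F))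
  have := congrArg (fun φ => φ f) this
  simp only [AlgHom.comp_apply, h, map_zero] at this
  exact this.symm

theorem contains_orbit_iff {f : MvPolynomial (Fin 3) F} {d : ℕ} (hf : f.IsHomogeneous d)
    (p : Plane (AlgebraicClosure F)) :
    Contains f (Set.range fun n : ℕ => (frobenius F)^[n] p) ↔ VanishesAt f p := by
  refine ⟨fun h => h p ⟨0, rfl⟩, ?_⟩
  rintro h _ ⟨n, rfl⟩
  change VanishesAt f ((frobenius F)^[n] p)
  induction n with
  | zero => exact h
  | succ n ih =>
    rw [Function.iterate_succ_apply']
    exact vanishesAt_frobenius hf ih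

/-- A point with a finite orbit under an injective map is fixed by the iterate whose exponent is the
cardinality of the orbit. -/
theorem iterate_ncard_orbit {α : Type*} {φ : α → α} (hφ : Function.Injective φ) {p : α}
    (h : (Set.range fun n : ℕ => φ^[n] p).Finite) :
    φ^[(Set.range fun n : ℕ => φ^[n] p).ncard] p = p := by
  obtain ⟨m, n, hmn, hne⟩ : ∃ m n : ℕ, φ^[m] p = φ^[n] p ∧ m ≠ n := by
    by_contra! hinj
    exact Set.infinite_range_of_injective (fun m n => hinj m n) h
  have hper : p ∈ Function.periodicPts φ := by
    wlog hlt : m < n generalizing m n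
    · exact this n m hmn.symm hne.symm (lt_of_le_of_ne (not_lt.mp hlt) hne.symm)
    refine Function.mk_mem_periodicPts (Nat.sub_pos_of_lt hlt) (hφ.iterate m ?_)
    rw [← Function.iterate_add_apply, Nat.add_sub_cancel' hlt.le, hmn]
  have hrange : (Set.range fun n : ℕ => φ^[n] p) =
      (fun n : ℕ => φ^[n] p) '' Set.Iio (Function.minimalPeriod φ p) := by
    refine Set.Subset.antisymm ?_ (Set.image_subset_range _ _)
    rintro _ ⟨n, rfl⟩
    exact ⟨n % Function.minimalPeriod φ p,
      Nat.mod_lt _ (Function.minimalPeriod_pos_of_mem_periodicPts hper),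
      Function.iterate_mod_minimalPeriod_eq⟩
  rw [hrange, Function.iterate_injOn_Iio_minimalPeriod.ncard_image,
    ← Finset.coe_Iio, Set.ncard_coe_finset, Nat.card_Iio, Function.iterate_minimalPeriod]

/-- Once some coordinate is scaled to `1`, the factor relating `v` to its image under the third
Frobenius iterate must be `1`. -/
theorem exists_rep_pow_card {p : Plane (AlgebraicClosure F)} (hp : (frobenius F)^[3] p = p) :
    ∃ (v : Fin 3 → AlgebraicClosure F) (hv : v ≠ 0), p = Projectivization.mk _ v hv ∧
      ∀ i, v i ^ Fintype.card F ^ 3 = v i := by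
  obtain ⟨i, hi⟩ : ∃ i, p.rep i ≠ 0 := Function.ne_iff.mp p.rep_nonzero
  have hpow : ∀ v : Fin 3 → AlgebraicClosure F, v i = 1 →
      (fun j => v j ^ Fintype.card F) i = 1 := fun v h => by simp [h]
  have hne : ∀ v : Fin 3 → AlgebraicClosure F, v i = 1 → v ≠ 0 := by
    rintro v h rfl
    exact zero_ne_one h
  let v := (p.rep i)⁻¹ • p.rep
  have hvi : v i = 1 := by simp [v, hi]
  have hpv : p = Projectivization.mk _ v (hne v hvi) := by
    conv_lhs => rw [← p.mk_rep]
    exact (Projectivization.mk_eq_mk_iff' _ _ _ _ _).mpr ⟨p.rep i, by simp [v, smul_smul, hi]⟩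
  refine ⟨v, hne v hvi, hpv, ?_⟩
  rw [hpv] at hp
  simp only [Function.iterate_succ_apply, Function.iterate_zero, id] at hp
  have h1 := hpow _ hvi
  have h2 := hpow (fun j => v j ^ Fintype.card F) h1
  have h3 := hpow (fun j => (v j ^ Fintype.card F) ^ Fintype.card F) h2
  rw [frobenius_mk v _ (hne _ h1), frobenius_mk _ _ (hne _ h2), frobenius_mk _ _ (hne _ h3),
    Projectivization.mk_eq_mk_iff'] at hp
  obtain ⟨a, ha⟩ := hp
  have ha1 : a = 1 := by simpa [hvi] using congrFun ha i
  intro j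
  have := congrFun ha j
  simp only [ha1, one_smul, ← pow_mul] at this
  have h4 : Fintype.card F ^ 3 = Fintype.card F * Fintype.card F * Fintype.card F := by ring
  rw [h4]
  exact this.symm

end

end PlaneCurves

theorem mainTheorem10 {F : Type*} [Field F] [Fintype F] (hq : 4 ≤ Fintype.card F)
    (P : Set (PlaneCurves.Plane (AlgebraicClosure F)))
    (hP : PlaneCurves.IsClosedPointOfDegree 3 P)
    (hline : PlaneCurves.InNoRationalLine (F := F) P) :
    (∀ C ∈ PlaneCurves.rationalLinearSystem (F := F) 4 P,
        (PlaneCurves.rationalPoints C).ncard ≤ 3 * Fintype.card F + 2) ∧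
      ∃ C ∈ PlaneCurves.rationalLinearSystem (F := F) 4 P,
        (PlaneCurves.rationalPoints C).ncard = 3 * Fintype.card F + 2 := by
  obtain ⟨⟨p, rfl⟩, hcard⟩ := hP
  have hp := PlaneCurves.iterate_ncard_orbit (PlaneCurves.frobenius_injective (F := F)) (p := p)
    (Set.finite_of_ncard_ne_zero (by rw [hcard]; norm_num))
  rw [hcard] at hp
  obtain ⟨v, hv0, rfl, hv⟩ := PlaneCurves.exists_rep_pow_card hp
  -- For a form over `F`, vanishing on the whole orbit amounts to vanishing at `v`; both the line
  -- hypothesis and membership in the linear system become conditions on `v`.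
  have hcont : ∀ {f : MvPolynomial (Fin 3) F} {d : ℕ}, f.IsHomogeneous d →
      (PlaneCurves.Contains f (Set.range fun n : ℕ => (PlaneCurves.frobenius F)^[n]
        (Projectivization.mk _ v hv0)) ↔ MvPolynomial.aeval v f = 0) := fun hf =>
    (PlaneCurves.contains_orbit_iff hf _).trans (PlaneCurves.vanishesAt_mk_iff hf v hv0)
  have hl : ∀ l : MvPolynomial (Fin 3) F, PlaneCurves.IsCurveEquation 1 l →
      MvPolynomial.aeval v l ≠ 0 := fun l hl h => hline l hl ((hcont hl.2).mpr h)
  refine ⟨fun C hC => PlaneCurves.ncard_rationalPoints_quartic_le hl hC.1.1 hC.1.2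
    ((hcont hC.1.2).mp hC.2), ?_⟩
  obtain ⟨c, hc, hcv⟩ := PlaneCurves.exists_conic hv
  have hf := PlaneCurves.isHomogeneous_conic c
  have hf0 := PlaneCurves.conic_ne_zero hc
  obtain ⟨a, b, ha, hb, hN⟩ := PlaneCurves.exists_ncard_rationalPoints_mul (by omega)
    (PlaneCurves.noLinearFactor_of_isHomogeneous_two hl hf0 hf hcv) hf
    (PlaneCurves.two_le_ncard_rationalPoints_conic c)
  have hhom := (hf.mul (PlaneCurves.isHomogeneous_linForm a)).mul
    (PlaneCurves.isHomogeneous_linForm b)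
  exact ⟨_, ⟨⟨mul_ne_zero (mul_ne_zero hf0 (PlaneCurves.linForm_ne_zero ha))
    (PlaneCurves.linForm_ne_zero hb), hhom⟩, (hcont hhom).mpr (by simp [hcv])⟩, hN⟩
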